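/- Let $G$ be a profinite group acting faithfully and continuously, by automorphisms, on a rooted tree $T$ (continuity means that all vertex stabilizers are open; thus $G$ is identified, as a topological group, with a closed subgroup of $\mathrm{Aut}(T)$). Assume that the action is weakly branch: $G$ is transitive on every level of $T$ and, for every vertex $s$, the rigid stabilizer of $s$ (the set of elements of $G$ fixing every vertex outside the subtree $T_s$ hanging from $s$) is non-trivial. Let $\mathcal X=\partial T$ be the set of infinite branches of $T$ starting at the root, with the induced action of $G$, and for $g\in G$ put $\mathrm{supp}(g)=\{x\in\mathcal X : g(x)\ne x\}$. Let $t\ge 0$, let $\mathbb F_t$ be the free group on $y_1,\dots,y_t$, and let $w(\bar y)\in\mathbb F_t * G$. The set $O_w\subseteq\mathcal X$ is defined as follows. If $w\in\mathbb F_t$, then $O_w=\mathcal X\setminus \mathrm{Fix}(G)$, where $\mathrm{Fix}(G)$ is the set of points fixed by all of $G$. If $w=u_nv_nu_{n-1}v_{n-1}\cdots u_1v_1$ is in reduced form with $n\ge 1$, $u_i\in\mathbb F_t$, $v_i\in G\setminus\{1\}$ (and $u_i\neq 1$ for $i<n$), then $$O_w=\bigcap_{i=0}^{n-1} v_1^{-1}v_2^{-1}\cdots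 v_i^{-1}\bigl(\mathrm{supp}(v_{i+1})\bigr).$$ The word $w$ is called explicitly oscillating if $w\neq 1$ in $\mathbb F_t*G$ and $O_w\ne\emptyset$. Then for every explicitly oscillating word $w(\bar y)\in\mathbb F_t*G$ (in $\mathbb F_t$ or of the above form) with $O_w=\mathcal X$, a random tuple $\bar\gamma=(\gamma_1,\dots,\gamma_t)\in G^t$, whose entries are independent and distributed according to the normalized Haar measure of $G$, satisfies $w(\bar\gamma)\neq 1$ almost surely. -/

import Mathlib

open MeasureTheory
open scoped Pointwise Monoid.Coprod

universe u v

/-! ## Words with constants and explicit oscillation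

Words over `G` in the variables `y₁, …, y_t` are elements of the free product
`FreeGroup (Fin t) ∗ G`. -/

section Words

/-- The value `w(γ)` of a word with constants under the substitution `yᵢ ↦ γᵢ`. -/
def wordEval {G : Type v} [Group G] {t : ℕ} (γ : Fin t → G) :
    FreeGroup (Fin t) ∗ G →* G :=
  Monoid.Coprod.lift (FreeGroup.lift γ) (MonoidHom.id G)

/-- `w` is written in the reduced form `uₙ vₙ uₙ₋₁ vₙ₋₁ ⋯ u₁ v₁` with `n ≥ 1`, constants
`vᵢ ∈ G \ {1}`, and `uᵢ` in the free group. The list is `[(u₁, v₁), …, (uₙ, vₙ)]`, so the product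
is taken in the reverse order. Being reduced means `uᵢ ≠ 1` for `i < n`; the leftmost factor `uₙ`
may be trivial. -/
structure IsConstantForm {G : Type v} [Group G] {t : ℕ} (w : FreeGroup (Fin t) ∗ G)
    (l : List (FreeGroup (Fin t) × G)) : Prop where
  ne_nil : l ≠ []
  constant_ne_one : ∀ p ∈ l, p.2 ≠ 1
  variable_ne_one : ∀ p ∈ l.dropLast, p.1 ≠ 1
  eq_prod : w = ((l.map fun p => Monoid.Coprod.inl p.1 * Monoid.Coprod.inr p.2).reverse).prod

/-- The support of a group element acting on `X`. -/
def actionSupport {G : Type v} [Group G] (X : Type u) [MulAction G X] (g : G) : Set X :=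
  {x | g • x ≠ x}

/-- `⋂_{i=0}^{n-1} v₁⁻¹ ⋯ vᵢ⁻¹ (supp vᵢ₊₁)` for the list `[(u₁, v₁), …, (uₙ, vₙ)]`. -/
def formOscSet {G : Type v} [Group G] (X : Type u) [MulAction G X] {t : ℕ}
    (l : List (FreeGroup (Fin t) × G)) : Set X :=
  ⋂ i : Fin l.length,
    ((l.take i).map fun p => p.2⁻¹).prod • actionSupport X (l.get i).2

/-- The set `O_w`: for `w` in the free group it is `X \ Fix(G)`, and for `w` of the form
`uₙ vₙ ⋯ u₁ v₁` (which determines the `uᵢ` and `vᵢ`) it is `⋂ v₁⁻¹ ⋯ vᵢ⁻¹ (supp vᵢ₊₁)`.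
For the remaining words (those involving constants whose rightmost letter is a variable)
`O_w` is only considered after passing to a conjugate of the above form, and it is empty here. -/
def oscSet {G : Type v} [Group G] (X : Type u) [MulAction G X] {t : ℕ}
    (w : FreeGroup (Fin t) ∗ G) : Set X :=
  {x | (w ∈ (Monoid.Coprod.inl : FreeGroup (Fin t) →* FreeGroup (Fin t) ∗ G).range ∧
          x ∉ MulAction.fixedPoints G X) ∨
        ∃ l : List (FreeGroup (Fin t) × G), IsConstantForm w l ∧ x ∈ formOscSet X l}

/-- `w` is explicitly oscillating in `V ⊆ X`: it is non-trivial and `V` meets `O_w`. -/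
def IsExplicitlyOscillatingIn {G : Type v} [Group G] {X : Type u} [MulAction G X] {t : ℕ}
    (w : FreeGroup (Fin t) ∗ G) (V : Set X) : Prop :=
  w ≠ 1 ∧ (V ∩ oscSet X w).Nonempty

/-- `w` is explicitly oscillating (in the whole space `X`). -/
def IsExplicitlyOscillating {G : Type v} [Group G] (X : Type u) [MulAction G X] {t : ℕ}
    (w : FreeGroup (Fin t) ∗ G) : Prop :=
  IsExplicitlyOscillatingIn w (Set.univ : Set X)

end Words

/-! ## Weakly branch actions and the boundary

A rooted tree is Mathlib's `RootedTree`: its vertices with the ancestor order, the root being `⊥`.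
An action by automorphisms of the rooted tree is an action that preserves this order,
`CovariantClass G T HSMul.hSMul LE.le`. The subtree hanging from `t` is `Set.Ici t`, and the level
of a vertex is its height `Order.height`. -/

section Trees

/-- The boundary of a rooted tree: the infinite branches starting at the root. -/
@[ext]
structure RootedTree.Boundary (T : RootedTree.{u}) where
  vertex : ℕ → T
  vertex_zero : vertex 0 = ⊥
  covBy : ∀ n, vertex n ⋖ vertex (n + 1)

/-- The induced action on the boundary, `(g • x)ₙ = g • xₙ`. -/
instance RootedTree.Boundary.instMulAction {G : Type v} [Group G] (T : RootedTree.{u})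
    [MulAction G T] [CovariantClass G T HSMul.hSMul LE.le] : MulAction G T.Boundary where
  smul g x :=
    { vertex := fun n => g • x.vertex n
      vertex_zero := by
        rw [x.vertex_zero]
        refine le_antisymm ?_ bot_le
        have h := smul_mono_right g (bot_le : (⊥ : T) ≤ g⁻¹ • (⊥ : T))
        simpa using h
      covBy := fun n => by
        have hmono : ∀ (h : G) {a b : T}, a < b → h • a < h • b := fun h a b hab =>
          lt_of_le_of_ne (smul_mono_right h hab.le)
            fun he => hab.ne (MulAction.injective h he)
        refine ⟨hmono g (x.covBy n).1, fun c h1 h2 => (x.covBy n).2 (c := g⁻¹ • c) ?_ ?_⟩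
        · simpa using hmono g⁻¹ h1
        · simpa using hmono g⁻¹ h2 }
  one_smul x := by
    ext n
    exact one_smul G (x.vertex n)
  mul_smul g h x := by
    ext n
    exact mul_smul g h (x.vertex n)

/-- The rigid stabilizer of the vertex `t`: the elements fixing every vertex outside the subtree
hanging from `t`. -/
def rigidStabilizer (G : Type v) [Group G] (T : RootedTree.{u}) [MulAction G T] (t : T) :
    Subgroup G :=
  fixingSubgroup G (Set.Ici t)ᶜ

/-- A weakly branch action on the rooted tree `T`: the group is faithfully represented as a group
of automorphisms, it is transitive on every level, and all rigid vertex stabilizers are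
non-trivial. -/
structure IsWeaklyBranchAction (G : Type v) [Group G] (T : RootedTree.{u}) [MulAction G T]
    [CovariantClass G T HSMul.hSMul LE.le] : Prop where
  faithful : FaithfulSMul G T
  spherically_transitive :
    ∀ a b : T, Order.height a = Order.height b → ∃ g : G, g • a = b
  rigid_nontrivial : ∀ t : T, rigidStabilizer G T t ≠ ⊥

end Trees

/-! ## Vertices on branches -/

section Branches

/-! Since `O_w` is the whole boundary, every constant in `w` is fixed-point-free there. Hence `w` is
a constant times a path of letters and constants in which cancelling letters are always separated by
a fixed-point-free constant. Follow one branch `x` along this path. It suffices that the trajectory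
almost surely never returns to a prescribed translate of an earlier point (`ae_pathVal_smul_ne`);
this is proved by induction on the path.

When a letter `a` is about to act on a point `p`, the induction hypothesis and separation ensure
that `p` is almost surely fresh: the earlier trajectory has not used the value of `a` at `p`
(`ne_of_mem_incidentPoints`). For `h` in the rigid stabilizer of a vertex of `p` high enough to
avoid all points incident to `a`, replacing `a` by `a * h` preserves Haar measure and the past
trajectory (`pathVal_twist_smul`), but sends `p` to `a h p`. Weak branching supplies arbitrarily
many such `h` with distinct values of `h p`, so a prescribed target is hit with probability at most
`1 / N` for every `N` (`measure_fresh_inter_eq_zero`). -/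

theorem RootedTree.height_eq_of_covBy {T : RootedTree.{u}} {a b : T} (h : a ⋖ b) :
    Order.height b = Order.height a + 1 := by
  refine le_antisymm ?_ (Order.height_add_one_le h.lt)
  rw [Order.height_eq_iSup_lt_height]
  refine iSup₂_le fun y hy => add_le_add_left (Order.height_mono ?_) 1
  rw [← h.pred_eq]
  exact Order.le_pred_of_lt hy

theorem RootedTree.exists_height_eq {T : RootedTree.{u}} (a : T) :
    ∃ n : ℕ, Order.height a = n := by
  obtain ⟨i, hi⟩ := exists_pred_iterate_of_le (bot_le : ⊥ ≤ a)
  induction i generalizing a with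
  | zero => exact ⟨0, by simp_all⟩
  | succ i ih =>
    obtain ⟨n, hn⟩ := ih (Order.pred a) hi
    by_cases ha : IsMin a
    · exact ⟨0, by simpa using ha⟩
    · exact ⟨n + 1, by
        rw [height_eq_of_covBy (Order.pred_covBy_of_not_isMin ha), hn]; norm_cast⟩

namespace RootedTree.Boundary

variable {T : RootedTree.{u}}

theorem pred_vertex_succ (x : T.Boundary) (n : ℕ) :
    Order.pred (x.vertex (n + 1)) = x.vertex n :=
  (x.covBy n).pred_eq

theorem height_vertex (x : T.Boundary) (n : ℕ) : Order.height (x.vertex n) = n := by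
  induction n with
  | zero => simp [x.vertex_zero]
  | succ n ih => rw [height_eq_of_covBy (x.covBy n), ih]; norm_cast

theorem vertex_mono (x : T.Boundary) : Monotone x.vertex :=
  monotone_nat_of_le_succ fun n => (x.covBy n).le

theorem vertex_eq_of_le {x y : T.Boundary} {m n : ℕ} (hmn : m ≤ n)
    (h : x.vertex n = y.vertex n) : x.vertex m = y.vertex m := by
  induction n, hmn using Nat.le_induction with
  | base => exact h
  | succ n _ ih =>
    apply ih
    rw [← pred_vertex_succ, h, pred_vertex_succ]

theorem exists_pred_iterate_vertex (y : T.Boundary) (i k : ℕ) :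
    ∃ l, Order.pred^[i] (y.vertex k) = y.vertex l ∧ l ≤ k := by
  induction i generalizing k with
  | zero => exact ⟨k, rfl, le_rfl⟩
  | succ i ih =>
    rw [Function.iterate_succ_apply]
    cases k with
    | zero =>
      obtain ⟨l, hl, hl0⟩ := ih 0
      exact ⟨l, by simpa [y.vertex_zero] using hl, hl0⟩
    | succ k =>
      obtain ⟨l, hl, hlk⟩ := ih k
      exact ⟨l, by rw [pred_vertex_succ, hl], hlk.trans k.le_succ⟩

/-- Iterated predecessors of a vertex of `y` stay on `y`, and the height identifies which vertex is
reached. -/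
theorem vertex_eq_of_vertex_le {x y : T.Boundary} {m k : ℕ} (h : x.vertex m ≤ y.vertex k) :
    x.vertex m = y.vertex m := by
  obtain ⟨i, hi⟩ := exists_pred_iterate_of_le h
  obtain ⟨l, hl, -⟩ := exists_pred_iterate_vertex y i k
  have hx : x.vertex m = y.vertex l := by rw [← hi, hl]
  have hh := congrArg Order.height hx
  rw [height_vertex, height_vertex, Nat.cast_inj] at hh
  rw [hx, hh]

/-- Distinct branches are separated at all sufficiently high levels. -/
theorem eventually_vertex_ne {x y : T.Boundary} (h : x ≠ y) :
    ∀ᶠ n in Filter.atTop, x.vertex n ≠ y.vertex n := by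
  obtain ⟨n, hn⟩ : ∃ n, x.vertex n ≠ y.vertex n := by
    by_contra! hxy
    exact h (RootedTree.Boundary.ext (funext hxy))
  filter_upwards [Filter.eventually_ge_atTop n] with k hk hxy
  exact hn (vertex_eq_of_le hk hxy)

theorem smul_vertex {G : Type v} [Group G] [MulAction G T] [CovariantClass G T HSMul.hSMul LE.le]
    (g : G) (x : T.Boundary) (n : ℕ) : (g • x).vertex n = g • x.vertex n :=
  rfl

end RootedTree.Boundary

end Branches

/-! ## Rigid stabilizers -/

section Rigid

open RootedTree RootedTree.Boundary

variable {G : Type v} [Group G] {T : RootedTree.{u}} [MulAction G T]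

theorem mem_rigidStabilizer {s : T} {g : G} :
    g ∈ rigidStabilizer G T s ↔ ∀ a, ¬ s ≤ a → g • a = a := by
  simp [rigidStabilizer, mem_fixingSubgroup_iff]

theorem rigidStabilizer_antitone {s s' : T} (h : s ≤ s') :
    rigidStabilizer G T s' ≤ rigidStabilizer G T s := fun _ hg =>
  mem_rigidStabilizer.2 fun a ha => mem_rigidStabilizer.1 hg a fun hs => ha (h.trans hs)

variable [CovariantClass G T HSMul.hSMul LE.le]

theorem conj_mem_rigidStabilizer {s : T} {g : G} (hg : g ∈ rigidStabilizer G T s) (f : G) :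
    f * g * f⁻¹ ∈ rigidStabilizer G T (f • s) := by
  refine mem_rigidStabilizer.2 fun a ha => ?_
  have : g • f⁻¹ • a = f⁻¹ • a := mem_rigidStabilizer.1 hg _ fun hs => ha <| by
    simpa using smul_mono_right f hs
  simp [mul_smul, this]

omit [CovariantClass G T HSMul.hSMul LE.le] in
theorem smul_vertex_eq_of_mem_rigidStabilizer {x y : T.Boundary} {n : ℕ} {h : G}
    (hh : h ∈ rigidStabilizer G T (x.vertex n)) (hxy : y.vertex n ≠ x.vertex n) (k : ℕ) :
    h • y.vertex k = y.vertex k :=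
  mem_rigidStabilizer.1 hh _ fun hle => hxy (vertex_eq_of_vertex_le hle).symm

/-- Otherwise `h • x` would leave the subtree at level `n`, where `h⁻¹` acts trivially, so `h⁻¹`
could not carry it back to `x`. -/
theorem smul_vertex_eq_self_of_mem_rigidStabilizer {x : T.Boundary} {n : ℕ} {h : G}
    (hh : h ∈ rigidStabilizer G T (x.vertex n)) : h • x.vertex n = x.vertex n := by
  by_contra hne
  have := smul_vertex_eq_of_mem_rigidStabilizer (y := h • x) (inv_mem hh) hne n
  rw [smul_vertex, inv_smul_smul] at this
  exact hne this.symm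

theorem IsWeaklyBranchAction.exists_smul_vertex_eq (hG : IsWeaklyBranchAction G T)
    (x : T.Boundary) (a : T) : ∃ (g : G) (n : ℕ), g • x.vertex n = a := by
  obtain ⟨n, hn⟩ := exists_height_eq a
  obtain ⟨g, hg⟩ := hG.spherically_transitive (x.vertex n) a (by rw [height_vertex, hn])
  exact ⟨g, n, hg⟩

/-- Each level is a single orbit, finite because an open subgroup of a compact group has finite
index. Countability lets events be split according to the vertex visited. -/
theorem IsWeaklyBranchAction.countable [TopologicalSpace G] [IsTopologicalGroup G] [CompactSpace G]
    (hG : IsWeaklyBranchAction G T) (hcont : ∀ a : T, IsOpen (MulAction.stabilizer G a : Set G))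
    (x : T.Boundary) : Countable T := by
  have horb (n : ℕ) : (MulAction.orbit G (x.vertex n)).Countable := by
    have := Subgroup.quotient_finite_of_isOpen _ (hcont (x.vertex n))
    have := Finite.of_equiv _ (MulAction.orbitEquivQuotientStabilizer G (x.vertex n)).symm
    exact Set.to_countable _
  refine Set.countable_univ_iff.1 ((Set.countable_iUnion horb).mono fun a _ => ?_)
  obtain ⟨g, n, rfl⟩ := hG.exists_smul_vertex_eq x a
  exact Set.mem_iUnion.2 ⟨n, g, rfl⟩

theorem IsWeaklyBranchAction.exists_rigid_smul_vertex_ne (hG : IsWeaklyBranchAction G T)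
    (x : T.Boundary) (n : ℕ) :
    ∃ k ≥ n, ∃ g ∈ rigidStabilizer G T (x.vertex n), g • x.vertex k ≠ x.vertex k := by
  have := hG.faithful
  obtain ⟨⟨g, hg⟩, hg1⟩ := Subgroup.ne_bot_iff_exists_ne_one.1 (hG.rigid_nontrivial (x.vertex n))
  replace hg1 : g ≠ 1 := fun h => hg1 (Subtype.ext h)
  obtain ⟨b, hb⟩ : ∃ b : T, g • b ≠ b := by
    by_contra! h
    exact hg1 (FaithfulSMul.eq_of_smul_eq_smul fun b : T => by rw [h, one_smul])
  obtain ⟨f, k, rfl⟩ := hG.exists_smul_vertex_eq x b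
  have hle : x.vertex n ≤ (f • x).vertex k := by
    by_contra hle
    exact hb (mem_rigidStabilizer.1 hg _ hle)
  -- The moved vertex lies on `f • x`, below `x.vertex n`. So `f` fixes `x.vertex n`, and
  -- conjugating by `f⁻¹` stays in the rigid stabilizer while transferring the movement to `x`.
  have hf : f⁻¹ • x.vertex n = x.vertex n := by
    rw [inv_smul_eq_iff]; exact vertex_eq_of_vertex_le hle
  have hmem := conj_mem_rigidStabilizer hg f⁻¹
  rw [hf] at hmem
  refine ⟨max k n, le_max_right _ _, _, hmem, fun he => hb ?_⟩
  have := vertex_eq_of_le (x := (f⁻¹ * g * f⁻¹⁻¹) • x) (le_max_left k n) he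
  rw [smul_vertex, mul_smul, mul_smul, inv_inv, inv_smul_eq_iff] at this
  exact this

/-- The orbits of rigid stabilizers on branches are infinite. -/
theorem IsWeaklyBranchAction.exists_rigid_injective (hG : IsWeaklyBranchAction G T)
    (x : T.Boundary) (N n : ℕ) :
    ∃ M ≥ n, ∃ h : Fin N → G, (∀ i, h i ∈ rigidStabilizer G T (x.vertex n)) ∧
      Function.Injective fun i => h i • x.vertex M := by
  induction N generalizing n with
  | zero => exact ⟨n, le_rfl, Fin.elim0, fun i => i.elim0, fun i => i.elim0⟩
  | succ N ih =>
    obtain ⟨k, hk, g, hg, hgk⟩ := hG.exists_rigid_smul_vertex_ne x n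
    obtain ⟨M, hM, h, hh, hinj⟩ := ih k
    refine ⟨M, hk.trans hM, Fin.cons g h, Fin.cases hg fun i =>
      rigidStabilizer_antitone (x.vertex_mono hk) (hh i), ?_⟩
    -- The elements `h i` are rigid below level `k` and fix `x.vertex k`, which `g` moves; this
    -- separates `g` from all of them.
    have hne (i : Fin N) : g • x.vertex M ≠ h i • x.vertex M := fun he => hgk <| by
      have := vertex_eq_of_le (x := g • x) (y := h i • x) hM he
      rwa [smul_vertex, smul_vertex, smul_vertex_eq_self_of_mem_rigidStabilizer (hh i)] at this
    intro i j
    refine Fin.cases ?_ (fun i => ?_) i <;> refine Fin.cases ?_ (fun j => ?_) j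
    · simp
    · intro he; exact (hne j he).elim
    · intro he; exact (hne i he.symm).elim
    · intro he; exact congrArg Fin.succ (hinj he)

/-- The level in `exists_rigid_injective` can be chosen independently of the branch. -/
theorem IsWeaklyBranchAction.exists_rigid_injective_uniform (hG : IsWeaklyBranchAction G T)
    (x : T.Boundary) (N n : ℕ) :
    ∃ M ≥ n, ∀ f : G, ∃ h : Fin N → G, (∀ i, h i ∈ rigidStabilizer G T (f • x.vertex n)) ∧
      Function.Injective fun i => h i • f • x.vertex M := by
  obtain ⟨M, hM, h, hh, hinj⟩ := hG.exists_rigid_injective x N n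
  refine ⟨M, hM, fun f => ⟨fun i => f * h i * f⁻¹, fun i => conj_mem_rigidStabilizer (hh i) f, ?_⟩⟩
  intro i j hij
  apply hinj
  simpa [mul_smul] using hij

end Rigid

/-! ## Trajectories of a point under a word with constants -/

section Trajectories

variable {G : Type v} [Group G] {ι : Type*}

/-- The value of a letter `yᵢ` or `yᵢ⁻¹` under the substitution `yᵢ ↦ γᵢ`. -/
def letterVal (γ : ι → G) (a : ι × Bool) : G :=
  bif a.2 then γ a.1 else (γ a.1)⁻¹

/-- The value of `a₁ c₁ a₂ c₂ ⋯ aₘ cₘ` for the list `[(a₁, c₁), …, (aₘ, cₘ)]`, where the `aᵢ` are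
letters and the `cᵢ` are constants. -/
def pathVal (γ : ι → G) : List ((ι × Bool) × G) → G
  | [] => 1
  | s :: L => letterVal γ s.1 * s.2 * pathVal γ L

/-- Every cancelling pair of letters is separated by a constant without fixed points. -/
def IsSeparatedPath (X : Type*) [MulAction G X] (L : List ((ι × Bool) × G)) : Prop :=
  L.IsChain fun s s' => s.1.1 = s'.1.1 → s.1.2 = s'.1.2 ∨ ∀ x : X, s.2 • x ≠ x

variable {α : Type*} [MulAction G α]

theorem letterVal_not (γ : ι → G) (i : ι) (b : Bool) :
    letterVal γ (i, !b) = (letterVal γ (i, b))⁻¹ := by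
  cases b <;> simp [letterVal]

variable [DecidableEq ι]

/-- The points of the trajectory of `x` to which the letter `a` has been applied, or which have been
obtained by applying the inverse of `a`. -/
def incidentPoints (γ : ι → G) (a : ι × Bool) (x : α) : List ((ι × Bool) × G) → List α
  | [] => []
  | s :: L =>
    if s.1.1 = a.1 then
      (if s.1.2 = a.2 then s.2 • pathVal γ L • x else pathVal γ (s :: L) • x) ::
        incidentPoints γ a x L
    else incidentPoints γ a x L

/-- The substitution which differs from `γ` in that the value of the letter `a` is multiplied by `h`
on the right. -/
def twist (a : ι × Bool) (h : G) (γ : ι → G) (i : ι) : G :=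
  if i = a.1 then (bif a.2 then γ i * h else h⁻¹ * γ i) else γ i

theorem letterVal_twist_self (a : ι × Bool) (h : G) (γ : ι → G) :
    letterVal (twist a h γ) a = letterVal γ a * h := by
  rcases a with ⟨i, _ | _⟩ <;> simp [letterVal, twist]

theorem letterVal_twist_of_ne {a b : ι × Bool} (hab : b.1 ≠ a.1) (h : G) (γ : ι → G) :
    letterVal (twist a h γ) b = letterVal γ b := by
  simp [letterVal, twist, hab]

theorem twist_inv_twist (a : ι × Bool) (h : G) (γ : ι → G) : twist a h⁻¹ (twist a h γ) = γ := by
  funext i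
  rcases a with ⟨j, _ | _⟩ <;> by_cases hij : i = j <;> simp [twist, hij]

theorem incidentPoints_subset {γ : ι → G} {a : ι × Bool} {x : α} {L L' : List ((ι × Bool) × G)}
    (h : L' <:+ L) : incidentPoints γ a x L' ⊆ incidentPoints γ a x L := by
  induction L with
  | nil => rw [List.suffix_nil.1 h]; exact fun _ h => h
  | cons s L ih =>
    rcases List.suffix_cons_iff.1 h with rfl | h
    · exact fun _ h => h
    · intro d hd
      have := ih h hd
      rw [incidentPoints]
      split_ifs <;> simp [this]

/-- The twist inserts `h` just before an occurrence of `a`, or `h⁻¹` just after an occurrence of its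
inverse. Either way the inserted element acts on an incident point. -/
theorem pathVal_twist_smul {γ : ι → G} {a : ι × Bool} {h : G} {x : α}
    {L : List ((ι × Bool) × G)} (hfix : ∀ d ∈ incidentPoints γ a x L, h • d = d) :
    pathVal (twist a h γ) L • x = pathVal γ L • x := by
  induction L with
  | nil => rfl
  | cons s L ih =>
    rw [pathVal, mul_smul, ih fun d hd => hfix d
      (incidentPoints_subset (List.suffix_cons s L) hd)]
    rcases s with ⟨⟨i, b⟩, c⟩
    by_cases hi : i = a.1
    · rcases a with ⟨j, b'⟩
      obtain rfl : i = j := hi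
      by_cases hb : b = b'
      · subst hb
        have := hfix (c • pathVal γ L • x) (by simp [incidentPoints])
        rw [letterVal_twist_self, mul_smul, mul_smul, this, pathVal, mul_smul, mul_smul]
      · obtain rfl : b = !b' := by cases b <;> cases b' <;> simp_all
        have := hfix (pathVal γ (((i, !b'), c) :: L) • x) (by simp [incidentPoints])
        rw [letterVal_not, letterVal_twist_self, mul_inv_rev, ← letterVal_not, mul_smul, mul_smul,
          inv_smul_eq_iff, ← mul_smul _ c, ← mul_smul _ _ x]
        exact this.symm
    · rw [letterVal_twist_of_ne hi, pathVal, mul_smul, mul_smul, mul_smul]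

theorem incidentPoints_twist {γ : ι → G} {a : ι × Bool} {h : G} {x : α}
    {L : List ((ι × Bool) × G)} (hfix : ∀ d ∈ incidentPoints γ a x L, h • d = d) :
    incidentPoints (twist a h γ) a x L = incidentPoints γ a x L := by
  induction L with
  | nil => rfl
  | cons s L ih =>
    have hL : ∀ d ∈ incidentPoints γ a x L, h • d = d := fun d hd => hfix d
      (incidentPoints_subset (List.suffix_cons s L) hd)
    rw [incidentPoints, incidentPoints, ih hL, pathVal_twist_smul hfix, pathVal_twist_smul hL]

theorem incidentPoints_map {β : Type*} [MulAction G β] (f : α → β)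
    (hf : ∀ (g : G) x, f (g • x) = g • f x) (γ : ι → G) (a : ι × Bool) (x : α)
    (L : List ((ι × Bool) × G)) :
    incidentPoints γ a (f x) L = (incidentPoints γ a x L).map f := by
  induction L with
  | nil => rfl
  | cons s L ih =>
    rw [incidentPoints, incidentPoints, ih]
    split_ifs <;> simp [hf]

/-- A point of the trajectory to which the next letter is applied is not incident to that letter,
provided that it is not a suitable translate of an earlier point. -/
theorem ne_of_mem_incidentPoints {γ : ι → G} {x : α} {s : (ι × Bool) × G}
    {L : List ((ι × Bool) × G)} (hs : IsSeparatedPath α (s :: L))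
    (hL : ∀ L', L' <:+ L → L' ≠ L → ∀ c ∈ 1 :: L.map Prod.snd,
      pathVal γ L • x ≠ (s.2⁻¹ * c) • pathVal γ L' • x) :
    ∀ d ∈ incidentPoints γ s.1 x L, d ≠ s.2 • pathVal γ L • x := by
  suffices H : ∀ L₁, L₁ <:+ L → ∀ d ∈ incidentPoints γ s.1 x L₁, d ≠ s.2 • pathVal γ L • x from
    H L List.suffix_rfl
  intro L₁
  induction L₁ with
  | nil => simp [incidentPoints]
  | cons s' L₂ ih =>
    intro hsuf d hd
    have hsuf₂ : L₂ <:+ L := (List.suffix_cons s' L₂).trans hsuf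
    have hne : L₂ ≠ L := fun h => by
      have := hsuf.length_le
      simp [h] at this
    rw [incidentPoints] at hd
    have tail := ih hsuf₂ d
    split_ifs at hd with h₁ h₂
    · rcases List.mem_cons.1 hd with rfl | hd
      · intro he
        refine hL L₂ hsuf₂ hne s'.2 (List.mem_cons_of_mem _ (List.mem_map_of_mem ?_)) ?_
        · exact hsuf.subset List.mem_cons_self
        · rw [mul_smul, he, inv_smul_smul]
      · exact tail hd
    · rcases List.mem_cons.1 hd with rfl | hd
      · intro he
        -- The inverse letter was the immediately preceding one: equality would give a fixed point
        -- of the constant in between, which separation excludes.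
        by_cases hL₁ : s' :: L₂ = L
        · subst hL₁
          rcases (List.isChain_cons_cons.1 hs).1 h₁.symm with hb | hb
          · exact h₂ hb.symm
          · exact hb _ he.symm
        · refine hL _ hsuf hL₁ 1 List.mem_cons_self ?_
          rw [mul_one, he, inv_smul_smul]
      · exact tail hd
    · exact tail hd

end Trajectories

/-! ## Random trajectories -/

/-! ### Measurability of trajectories in a countable discrete space. -/

section Measurability

variable {G : Type v} [Group G] [TopologicalSpace G] [IsTopologicalGroup G] [MeasurableSpace G]
  [BorelSpace G] {ι : Type*}

theorem measurable_letterVal (a : ι × Bool) : Measurable fun γ : ι → G => letterVal γ a := by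
  rcases a with ⟨i, _ | _⟩
  · exact (measurable_pi_apply i).inv
  · exact measurable_pi_apply i

variable {α : Type*} [MulAction G α] [Countable α] [MeasurableSpace α] [DiscreteMeasurableSpace α]

omit [DiscreteMeasurableSpace α] in
theorem measurable_smul_of_isOpen_stabilizer
    (hα : ∀ a : α, IsOpen (MulAction.stabilizer G a : Set G)) (a : α) :
    Measurable fun g : G => g • a := by
  refine measurable_to_countable' fun b => IsOpen.measurableSet ?_
  by_cases hb : ∃ g : G, g • a = b
  · obtain ⟨g, rfl⟩ := hb
    convert (hα a).preimage (continuous_const_mul g⁻¹) using 1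
    ext k
    simp [mul_smul, inv_smul_eq_iff]
  · convert isOpen_empty
    ext k
    simpa using fun h => hb ⟨k, h⟩

theorem measurable_letterVal_smul (hα : ∀ a : α, IsOpen (MulAction.stabilizer G a : Set G))
    (a : ι × Bool) {f : (ι → G) → α} (hf : Measurable f) :
    Measurable fun γ : ι → G => letterVal γ a • f γ := by
  have : Measurable fun q : (ι → G) × α => letterVal q.1 a • q.2 :=
    measurable_from_prod_countable_left fun b =>
      (measurable_smul_of_isOpen_stabilizer hα b).comp (measurable_letterVal a)
  exact this.comp (measurable_id.prodMk hf)

theorem measurable_pathVal_smul (hα : ∀ a : α, IsOpen (MulAction.stabilizer G a : Set G))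
    (L : List ((ι × Bool) × G)) (x : α) : Measurable fun γ : ι → G => pathVal γ L • x := by
  induction L with
  | nil => simp only [pathVal, measurable_const]
  | cons s L ih =>
    simp only [pathVal, mul_smul]
    exact measurable_letterVal_smul hα s.1 ((measurable_of_countable (s.2 • · : α → α)).comp ih)

variable [DecidableEq ι]

theorem measurableSet_forall_mem_incidentPoints_ne
    (hα : ∀ a : α, IsOpen (MulAction.stabilizer G a : Set G)) (a : ι × Bool)
    (L : List ((ι × Bool) × G)) (x : α) {f : (ι → G) → α} (hf : Measurable f) :
    MeasurableSet {γ : ι → G | ∀ d ∈ incidentPoints γ a x L, d ≠ f γ} := by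
  induction L with
  | nil => simp [incidentPoints]
  | cons s L ih =>
    have hne {g : (ι → G) → α} (hg : Measurable g) : MeasurableSet {γ | g γ ≠ f γ} :=
      (measurableSet_eq_fun hg hf).compl
    simp only [incidentPoints]
    split_ifs
    · simp only [List.forall_mem_cons]
      exact (hne ((measurable_of_countable (s.2 • · : α → α)).comp
        (measurable_pathVal_smul hα L x))).inter ih
    · simp only [List.forall_mem_cons]
      exact (hne (measurable_pathVal_smul hα (s :: L) x)).inter ih
    · exact ih

end Measurability

/-! ### Disjoint preimages and the invariance of Haar measure under twists. -/

section Measures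

theorem natCast_mul_measure_le_of_disjoint_preimage {Ω : Type*} [MeasurableSpace Ω]
    {P : Measure Ω} {N : ℕ} {φ : Fin N → Ω → Ω} (hφ : ∀ i, MeasurePreserving (φ i) P P)
    {B C : Set Ω} (hB : MeasurableSet B) (hBC : ∀ i, φ i ⁻¹' B ⊆ C)
    (hdisj : Pairwise fun i j => Disjoint (φ i ⁻¹' B) (φ j ⁻¹' B)) : N * P B ≤ P C := by
  calc N * P B = ∑ i : Fin N, P (φ i ⁻¹' B) := by
        simp [(hφ _).measure_preimage hB.nullMeasurableSet]
    _ = P (⋃ i, φ i ⁻¹' B) := by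
        rw [measure_iUnion hdisj fun i => (hφ i).measurable hB, tsum_fintype]
    _ ≤ P C := measure_mono (Set.iUnion_subset hBC)

/-- Compact groups are unimodular: a right translate of `μ` is again a Haar probability measure,
hence equals `μ`. -/
theorem measurePreserving_mul_right_of_compactSpace {G : Type v} [Group G] [TopologicalSpace G]
    [IsTopologicalGroup G] [CompactSpace G] [MeasurableSpace G] [BorelSpace G] (μ : Measure G)
    [μ.IsHaarMeasure] [IsProbabilityMeasure μ] (g : G) : MeasurePreserving (· * g) μ μ := by
  have hm : Measurable fun k : G => k * g := measurable_mul_const g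
  have := Measure.isProbabilityMeasure_map (μ := μ) hm.aemeasurable
  have : (μ.map (· * g)).IsHaarMeasure := Measure.isHaarMeasure_map_mul_right μ g
  exact ⟨hm, Measure.isHaarMeasure_eq_of_isProbabilityMeasure _ _⟩

theorem measurePreserving_twist {G : Type v} [Group G] [TopologicalSpace G]
    [IsTopologicalGroup G] [CompactSpace G] [MeasurableSpace G] [BorelSpace G] (μ : Measure G)
    [μ.IsHaarMeasure] [IsProbabilityMeasure μ] {ι : Type*} [Fintype ι] [DecidableEq ι]
    (a : ι × Bool) (h : G) :
    MeasurePreserving (twist a h) (Measure.pi fun _ : ι => μ) (Measure.pi fun _ : ι => μ) := by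
  refine measurePreserving_pi (fun _ => μ) (fun _ => μ)
    (f := fun i g => if i = a.1 then (bif a.2 then g * h else h⁻¹ * g) else g) fun i => ?_
  by_cases hi : i = a.1
  · cases ha : a.2
    · simpa [hi] using measurePreserving_mul_left μ h⁻¹
    · simpa [hi] using measurePreserving_mul_right_of_compactSpace μ h
  · simpa [hi] using! MeasurePreserving.id μ

end Measures

/-! ### Almost sure non-return of a trajectory. -/

section RandomTrajectories

open RootedTree RootedTree.Boundary

variable {G : Type v} [Group G] {T : RootedTree.{u}} [MulAction G T]
  [CovariantClass G T HSMul.hSMul LE.le] {ι : Type*} [DecidableEq ι]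

theorem incidentPoints_vertex (γ : ι → G) (a : ι × Bool) (x : T.Boundary) (n : ℕ)
    (L : List ((ι × Bool) × G)) :
    incidentPoints γ a (x.vertex n) L = (incidentPoints γ a x L).map fun d => d.vertex n :=
  incidentPoints_map (fun d : T.Boundary => d.vertex n) (fun _ _ => rfl) γ a x L

/-- If all points incident to the letter `a` leave the branch `y` before level `n`, they are not
affected by twisting `a` by the rigid stabilizer of the `n`-th vertex of `y`. -/
theorem smul_eq_of_mem_incidentPoints {γ : ι → G} {a : ι × Bool} {x y : T.Boundary} {n : ℕ}
    {L : List ((ι × Bool) × G)}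
    (hy : ∀ d ∈ incidentPoints γ a (x.vertex n) L, d ≠ y.vertex n) {h : G}
    (hh : h ∈ rigidStabilizer G T (y.vertex n)) : ∀ d ∈ incidentPoints γ a x L, h • d = d := by
  intro d hd
  refine RootedTree.Boundary.ext (funext fun k => ?_)
  refine smul_vertex_eq_of_mem_rigidStabilizer hh (hy _ ?_) k
  rw [incidentPoints_vertex]
  exact List.mem_map_of_mem hd

variable [TopologicalSpace G] [IsTopologicalGroup G] [CompactSpace G] [MeasurableSpace G]
  [BorelSpace G] [Fintype ι]

/-- Freshness is required at a fixed level `n`, so that the rigid stabilizer used for twisting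
depends only on a vertex and not on the random branch. -/
theorem measure_fresh_inter_eq_zero (hcont : ∀ a : T, IsOpen (MulAction.stabilizer G a : Set G))
    (hG : IsWeaklyBranchAction G T) (μ : Measure G) [μ.IsHaarMeasure] [IsProbabilityMeasure μ]
    (x : T.Boundary) (s : (ι × Bool) × G) {L L' : List ((ι × Bool) × G)} (hL' : L' <:+ L) (c : G)
    (n : ℕ) :
    (Measure.pi fun _ : ι => μ) {γ | (∀ d ∈ incidentPoints γ s.1 (x.vertex n) L,
      d ≠ s.2 • pathVal γ L • x.vertex n) ∧
        pathVal γ (s :: L) • x = c • pathVal γ L' • x} = 0 := by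
  have : Countable T := hG.countable hcont x
  let _ : MeasurableSpace T := ⊤
  set P := Measure.pi fun _ : ι => μ
  set B : Set (ι → G) := _
  change P B = 0
  suffices H : ∀ N : ℕ, N * P B ≤ 1 by
    by_contra h0
    obtain ⟨N, hN⟩ := ENNReal.exists_nat_mul_gt h0 ENNReal.one_ne_top
    exact (H N).not_gt hN
  intro N
  obtain ⟨M, hM, hf⟩ := hG.exists_rigid_injective_uniform x N n
  have hsm (k : ℕ) : Measurable fun γ : ι → G => s.2 • pathVal γ L • x.vertex k :=
    (measurable_of_countable (s.2 • · : T → T)).comp (measurable_pathVal_smul hcont L _)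
  -- Split by the level-`M` vertex `a` of the point about to be moved; `D a` adds that its image
  -- hits the target at level `M`. The twists can then be chosen for each `a` separately.
  let C (a : T) : Set (ι → G) :=
    {γ | (∀ d ∈ incidentPoints γ s.1 (x.vertex n) L, d ≠ s.2 • pathVal γ L • x.vertex n) ∧
      s.2 • pathVal γ L • x.vertex M = a}
  let D (a : T) : Set (ι → G) :=
    C a ∩ {γ | letterVal γ s.1 • a = c • pathVal γ L' • x.vertex M}
  have hCm (a : T) : MeasurableSet (C a) :=
    (measurableSet_forall_mem_incidentPoints_ne hcont _ _ _ (hsm n)).inter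
      (measurableSet_eq_fun (hsm M) measurable_const)
  have hDm (a : T) : MeasurableSet (D a) :=
    (hCm a).inter (measurableSet_eq_fun (measurable_letterVal_smul hcont _ measurable_const)
      ((measurable_of_countable (c • · : T → T)).comp (measurable_pathVal_smul hcont L' _)))
  have hBD : B ⊆ ⋃ a, D a := by
    rintro γ ⟨hγ, he⟩
    refine Set.mem_iUnion.2 ⟨_, ⟨hγ, rfl⟩, ?_⟩
    have := congrArg (fun d : T.Boundary => d.vertex M) he
    rw [Set.mem_ofPred_eq]
    simpa only [pathVal, mul_smul, smul_vertex] using this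
  have key (a : T) : N * P (D a) ≤ P (C a) := by
    by_cases ha : ∃ f : G, f • x.vertex M = a
    swap
    · have : D a = ∅ := Set.eq_empty_of_forall_notMem fun γ hγ => ha
        ⟨s.2 * pathVal γ L, by rw [mul_smul]; exact hγ.1.2⟩
      simp [this]
    obtain ⟨f, rfl⟩ := ha
    obtain ⟨h, hh, hinj⟩ := hf f
    -- Untwisting by `(h i)⁻¹` fixes all incident points, so it changes neither the trajectory nor
    -- the target.
    have inv {γ : ι → G} {i : Fin N} (hγ : twist s.1 (h i) γ ∈ C (f • x.vertex M)) :
        γ ∈ C (f • x.vertex M) ∧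
          pathVal γ L' • x = pathVal (twist s.1 (h i) γ) L' • x := by
      set γ' := twist s.1 (h i) γ with hγ'
      have htw : γ = twist s.1 (h i)⁻¹ γ' := (twist_inv_twist _ _ _).symm
      have hn : s.2 • pathVal γ' L • x.vertex n = f • x.vertex n :=
        vertex_eq_of_le (x := s.2 • pathVal γ' L • x) (y := f • x) hM hγ.2
      have hfix : ∀ d ∈ incidentPoints γ' s.1 x L, (h i)⁻¹ • d = d :=
        smul_eq_of_mem_incidentPoints (y := f • x) (n := n)
          (fun d hd => by rw [smul_vertex, ← hn]; exact hγ.1 d hd) (inv_mem (hh i))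
      have hL : pathVal γ L • x = pathVal γ' L • x := by
        rw [htw]; exact pathVal_twist_smul hfix
      have hv (k : ℕ) : pathVal γ L • x.vertex k = pathVal γ' L • x.vertex k :=
        congrArg (fun d : T.Boundary => d.vertex k) hL
      refine ⟨⟨?_, ?_⟩, ?_⟩
      · rw [hv, incidentPoints_vertex, htw, incidentPoints_twist hfix, ← incidentPoints_vertex]
        exact hγ.1
      · rw [hv]; exact hγ.2
      · rw [htw]; exact pathVal_twist_smul fun d hd => hfix d (incidentPoints_subset hL' hd)
    refine natCast_mul_measure_le_of_disjoint_preimage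
      (fun i => measurePreserving_twist μ s.1 (h i)) (hDm _) (fun i γ hγ => (inv hγ.1).1) ?_
    -- A common point of two preimages would have the same target for both twists, forcing `h i` and
    -- `h j` to agree on `a`.
    intro i j hij
    refine Set.disjoint_left.2 fun γ hi hj => hij (hinj ?_)
    have eq {i : Fin N} (hi : twist s.1 (h i) γ ∈ D (f • x.vertex M)) :
        letterVal γ s.1 • h i • f • x.vertex M = c • pathVal γ L' • x.vertex M := by
      have h1 := hi.2
      have h2 := congrArg (fun d : T.Boundary => d.vertex M) (inv hi.1).2
      simp only [Set.mem_ofPred_eq, letterVal_twist_self, mul_smul] at h1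
      simp only [smul_vertex] at h2
      rw [h1, h2]
    exact MulAction.injective (letterVal γ s.1) ((eq hi).trans (eq hj).symm)
  calc N * P B ≤ N * ∑' a, P (D a) := by
        gcongr
        exact (measure_mono hBD).trans (measure_iUnion_le _)
    _ = ∑' a, N * P (D a) := ENNReal.tsum_mul_left.symm
    _ ≤ ∑' a, P (C a) := ENNReal.tsum_le_tsum key
    _ = P (⋃ a, C a) := (measure_iUnion (fun a b hab => Set.disjoint_left.2
        fun γ ha hb => hab (ha.2.symm.trans hb.2)) hCm).symm
    _ ≤ 1 := prob_le_one

/-- Finitely many incident branches differ from the current one, so some level separates them all;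
the null sets are then combined over countably many levels. -/
theorem ae_pathVal_cons_smul_ne (hcont : ∀ a : T, IsOpen (MulAction.stabilizer G a : Set G))
    (hG : IsWeaklyBranchAction G T) (μ : Measure G) [μ.IsHaarMeasure] [IsProbabilityMeasure μ]
    (x : T.Boundary) (s : (ι × Bool) × G) {L L' : List ((ι × Bool) × G)} (hL' : L' <:+ L) (c : G)
    (hfresh : ∀ᵐ γ ∂(Measure.pi fun _ : ι => μ),
      ∀ d ∈ incidentPoints γ s.1 x L, d ≠ s.2 • pathVal γ L • x) :
    ∀ᵐ γ ∂(Measure.pi fun _ : ι => μ), pathVal γ (s :: L) • x ≠ c • pathVal γ L' • x := by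
  have hn := ae_all_iff.2 fun n => measure_eq_zero_iff_ae_notMem.1
    (measure_fresh_inter_eq_zero hcont hG μ x s hL' c n)
  filter_upwards [hfresh, hn] with γ hγ hnγ he
  have hev : ∀ᶠ n in Filter.atTop, ∀ d ∈ {d | d ∈ incidentPoints γ s.1 x L},
      d.vertex n ≠ (s.2 • pathVal γ L • x).vertex n :=
    (Filter.eventually_all_finite (List.finite_toSet _)).2 fun d hd =>
      eventually_vertex_ne (hγ d hd)
  obtain ⟨n, hn⟩ := hev.exists
  refine hnγ n ⟨fun d hd => ?_, he⟩
  rw [incidentPoints_vertex] at hd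
  obtain ⟨d', hd', rfl⟩ := List.mem_map.1 hd
  exact hn d' hd'

/-- Almost surely the trajectory of a branch under a separated path does not return to a given
translate of an earlier point. -/
theorem ae_pathVal_smul_ne (hcont : ∀ a : T, IsOpen (MulAction.stabilizer G a : Set G))
    (hG : IsWeaklyBranchAction G T) (μ : Measure G) [μ.IsHaarMeasure] [IsProbabilityMeasure μ]
    (x : T.Boundary) {L : List ((ι × Bool) × G)} (hL : IsSeparatedPath T.Boundary L)
    {L' : List ((ι × Bool) × G)} (hL' : L' <:+ L) (hne : L' ≠ L) (c : G) :
    ∀ᵐ γ ∂(Measure.pi fun _ : ι => μ), pathVal γ L • x ≠ c • pathVal γ L' • x := by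
  induction L generalizing L' c with
  | nil => exact (hne (List.suffix_nil.1 hL')).elim
  | cons s L ih =>
    have hL'' : L' <:+ L := (List.suffix_cons_iff.1 hL').resolve_left hne
    refine ae_pathVal_cons_smul_ne hcont hG μ x s hL'' c ?_
    -- Only finitely many suffixes and constants matter, so the induction hypothesis holds for all
    -- of them simultaneously outside a null set.
    have hall : ∀ᵐ γ ∂(Measure.pi fun _ : ι => μ), ∀ L' ∈ {L' | L' ∈ L.tails},
        L' ≠ L → ∀ c ∈ {c | c ∈ 1 :: L.map Prod.snd},
          pathVal γ L • x ≠ (s.2⁻¹ * c) • pathVal γ L' • x :=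
      (Filter.eventually_all_finite (List.finite_toSet _)).2 fun L' hL' =>
        Filter.eventually_imp_distrib_left.2 fun hne =>
          (Filter.eventually_all_finite (List.finite_toSet _)).2 fun c _ =>
            ih (List.IsChain.tail hL) ((List.mem_tails _ _).1 hL') hne _
    filter_upwards [hall] with γ hγ
    exact ne_of_mem_incidentPoints hL fun L' hL' hne c hc =>
      hγ L' ((List.mem_tails _ _).2 hL') hne c hc

end RandomTrajectories

/-! ## Uniqueness of the reduced form -/

section ReducedForm

/-- The two factors of a free product, as a family indexed by `Bool`. -/
def FactorFamily (A : Type u) (B : Type v) : Bool → Type (max u v)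
  | true => ULift.{v} A
  | false => ULift.{u} B

instance {A : Type u} {B : Type v} [Group A] [Group B] : ∀ b, Group (FactorFamily A B b)
  | true => inferInstanceAs (Group (ULift.{v} A))
  | false => inferInstanceAs (Group (ULift.{u} B))

variable {A : Type u} {B : Type v} [Group A] [Group B]

/-- The embedding of the left factor into `FactorFamily A B`. -/
def FactorFamily.left : A →* FactorFamily A B true :=
  (MulEquiv.ulift.symm : A ≃* ULift.{v} A).toMonoidHom

/-- The embedding of the right factor into `FactorFamily A B`. -/
def FactorFamily.right : B →* FactorFamily A B false :=
  (MulEquiv.ulift.symm : B ≃* ULift.{u} B).toMonoidHom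

theorem FactorFamily.left_injective :
    Function.Injective (left : A →* FactorFamily A B true) :=
  (MulEquiv.ulift.symm : A ≃* ULift.{v} A).injective

theorem FactorFamily.right_injective :
    Function.Injective (right : B →* FactorFamily A B false) :=
  (MulEquiv.ulift.symm : B ≃* ULift.{u} B).injective

open FactorFamily

/-- The canonical map from the binary free product to the indexed one. -/
def Monoid.Coprod.toCoprodI : A ∗ B →* Monoid.CoprodI (FactorFamily A B) :=
  Monoid.Coprod.lift (Monoid.CoprodI.of.comp left) (Monoid.CoprodI.of.comp right)

open Classical in
/-- The letters of the inverse of `uₙ vₙ ⋯ u₁ v₁`. -/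
noncomputable def inverseLetters : List (A × B) → List (Σ b, FactorFamily A B b)
  | [] => []
  | p :: l => ⟨false, right p.2⁻¹⟩ ::
      if p.1 = 1 then [] else ⟨true, left p.1⁻¹⟩ :: inverseLetters l

/-- Reducedness of the expression `uₙ vₙ ⋯ u₁ v₁`. -/
def IsReducedForm (l : List (A × B)) : Prop :=
  (∀ p ∈ l, p.2 ≠ 1) ∧ ∀ p ∈ l.dropLast, p.1 ≠ 1

theorem IsReducedForm.tail {p : A × B} {l : List (A × B)} (h : IsReducedForm (p :: l)) :
    IsReducedForm l := by
  refine ⟨fun q hq => h.1 q (List.mem_cons_of_mem p hq), fun q hq => h.2 q ?_⟩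
  cases l with
  | nil => simp at hq
  | cons r l => exact List.mem_cons_of_mem p hq

/-- Justifies stopping `inverseLetters` at a trivial `p.1`: only the final pair may have one. -/
theorem IsReducedForm.eq_nil {p : A × B} {l : List (A × B)} (h : IsReducedForm (p :: l))
    (hp : p.1 = 1) : l = [] := by
  cases l with
  | nil => rfl
  | cons r l => exact (h.2 p (by simp) hp).elim

theorem fst_eq_false_of_mem_head?_inverseLetters (l : List (A × B)) :
    ∀ x ∈ (inverseLetters l).head?, x.1 = false := by
  cases l <;> simp [inverseLetters]

theorem isChain_inverseLetters (l : List (A × B)) :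
    (inverseLetters l).IsChain fun x y => x.1 ≠ y.1 := by
  induction l with
  | nil => exact List.isChain_nil
  | cons p l ih =>
    rw [inverseLetters]
    split_ifs
    · exact List.isChain_singleton _
    · refine List.isChain_cons_cons.2 ⟨by simp, ih.cons fun x hx => ?_⟩
      simp [fst_eq_false_of_mem_head?_inverseLetters l x hx]

theorem IsReducedForm.ne_one_of_mem_inverseLetters {l : List (A × B)} (h : IsReducedForm l) :
    ∀ x ∈ inverseLetters l, x.2 ≠ 1 := by
  induction l with
  | nil => simp [inverseLetters]
  | cons p l ih =>
    have hp : right (A := A) p.2⁻¹ ≠ 1 := by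
      rw [Ne, map_eq_one_iff _ right_injective, inv_eq_one]
      exact h.1 p List.mem_cons_self
    rw [inverseLetters]
    split_ifs with h1
    · simpa using hp
    · refine List.forall_mem_cons.2 ⟨hp, List.forall_mem_cons.2 ⟨?_, ih h.tail⟩⟩
      change left (B := B) p.1⁻¹ ≠ 1
      rwa [Ne, map_eq_one_iff _ left_injective, inv_eq_one]

theorem IsReducedForm.prod_inverseLetters {l : List (A × B)} (h : IsReducedForm l) :
    ((inverseLetters l).map fun x => Monoid.CoprodI.of x.2).prod =
      Monoid.Coprod.toCoprodI
        ((l.map fun p => Monoid.Coprod.inl p.1 * Monoid.Coprod.inr p.2).reverse).prod⁻¹ := by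
  induction l with
  | nil => simp [inverseLetters]
  | cons p l ih =>
    rw [inverseLetters]
    split_ifs with h1
    · obtain rfl := h.eq_nil h1
      simp [h1, Monoid.Coprod.toCoprodI]
    · simp only [List.map_cons, List.prod_cons, ih h.tail, List.reverse_cons, List.prod_append,
        mul_inv_rev, map_mul, List.prod_nil, mul_one, ← map_inv]
      simp [Monoid.Coprod.toCoprodI, mul_assoc]

theorem IsReducedForm.inverseLetters_injective {l l' : List (A × B)} (h : IsReducedForm l)
    (h' : IsReducedForm l') (he : inverseLetters l = inverseLetters l') : l = l' := by
  induction l generalizing l' with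
  | nil => cases l' with
    | nil => rfl
    | cons => simp [inverseLetters] at he
  | cons p l ih => cases l' with
    | nil => simp [inverseLetters] at he
    | cons p' l' =>
      rw [inverseLetters, inverseLetters, List.cons.injEq] at he
      have h2 : p.2 = p'.2 := by
        simpa [right_injective.eq_iff] using he.1
      have he' := he.2
      split_ifs at he' with h1 h1' h1'
      · rw [h.eq_nil h1, h'.eq_nil h1', Prod.ext (h1.trans h1'.symm) h2]
      · rw [List.cons.injEq] at he'
        have h3 : p.1 = p'.1 := by
          simpa [left_injective.eq_iff] using he'.1
        rw [ih h.tail h'.tail he'.2, Prod.ext h3 h2]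

/-- Uniqueness of normal forms in the indexed free product, applied to the inverse element, whose
letters appear in the order of the list. -/
theorem IsReducedForm.eq_of_prod_eq {l l' : List (A × B)} (h : IsReducedForm l)
    (h' : IsReducedForm l')
    (he : ((l.map fun p => Monoid.Coprod.inl p.1 * Monoid.Coprod.inr p.2).reverse).prod =
      (((l'.map fun p => Monoid.Coprod.inl p.1 * Monoid.Coprod.inr p.2).reverse).prod : A ∗ B)) :
    l = l' := by
  classical
  refine h.inverseLetters_injective h' ?_
  have : (⟨_, h.ne_one_of_mem_inverseLetters, isChain_inverseLetters l⟩ :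
      Monoid.CoprodI.Word (FactorFamily A B)) =
      ⟨_, h'.ne_one_of_mem_inverseLetters, isChain_inverseLetters l'⟩ := by
    apply Monoid.CoprodI.Word.equiv.symm.injective
    change Monoid.CoprodI.Word.prod _ = Monoid.CoprodI.Word.prod _
    rw [Monoid.CoprodI.Word.prod, Monoid.CoprodI.Word.prod, h.prod_inverseLetters,
      h'.prod_inverseLetters, he]
  exact congrArg Monoid.CoprodI.Word.toList this

theorem IsConstantForm.unique {G : Type v} [Group G] {t : ℕ} {w : FreeGroup (Fin t) ∗ G}
    {l l' : List (FreeGroup (Fin t) × G)} (h : IsConstantForm w l) (h' : IsConstantForm w l') :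
    l = l' :=
  IsReducedForm.eq_of_prod_eq ⟨h.constant_ne_one, h.variable_ne_one⟩
    ⟨h'.constant_ne_one, h'.variable_ne_one⟩ (h.eq_prod.symm.trans h'.eq_prod)

end ReducedForm

/-! ## Words as paths -/

section WordPaths

variable {G : Type v} [Group G] {ι : Type*}

/-- The path which prepends the letters of `W`, the last of them followed by the constant `v`. -/
def prependLetters (v : G) (L : List ((ι × Bool) × G)) : List (ι × Bool) → List ((ι × Bool) × G)
  | [] => L
  | [a] => (a, v) :: L
  | a :: b :: W => (a, 1) :: prependLetters v L (b :: W)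

theorem prependLetters_cons_eq (v : G) (L : List ((ι × Bool) × G)) (a : ι × Bool)
    (W : List (ι × Bool)) : ∃ c L', prependLetters v L (a :: W) = (a, c) :: L' := by
  cases W <;> exact ⟨_, _, rfl⟩

theorem pathVal_prependLetters (γ : ι → G) (v : G) (L : List ((ι × Bool) × G))
    {W : List (ι × Bool)} (hW : W ≠ []) :
    pathVal γ (prependLetters v L W) =
      FreeGroup.lift γ (FreeGroup.mk W) * v * pathVal γ L := by
  induction W with
  | nil => exact (hW rfl).elim
  | cons a W ih => cases W with
    | nil => simp [prependLetters, pathVal, letterVal]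
    | cons b W =>
      rw [prependLetters, pathVal, ih (List.cons_ne_nil b W)]
      simp [letterVal, mul_assoc]

/-- Inside a reduced `W` no neighbours cancel, so only the junction with `L`, across `v`, needs a
fixed-point-free constant. -/
theorem IsSeparatedPath.prependLetters {X : Type*} [MulAction G X] {v : G}
    {L : List ((ι × Bool) × G)} (hL : IsSeparatedPath X L) (hv : L = [] ∨ ∀ x : X, v • x ≠ x)
    {W : List (ι × Bool)} (hW : FreeGroup.IsReduced W) :
    IsSeparatedPath X (prependLetters v L W) := by
  induction W with
  | nil => exact hL
  | cons a W ih => cases W with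
    | nil =>
      rcases hv with rfl | hv
      · exact List.isChain_singleton _
      · exact List.IsChain.cons hL fun _ _ _ => Or.inr hv
    | cons b W =>
      obtain ⟨hab, hW⟩ := FreeGroup.isReduced_cons_cons.1 hW
      have := ih hW
      rw [_root_.prependLetters]
      obtain ⟨c, L', he⟩ := prependLetters_cons_eq v L b W
      rw [he] at this ⊢
      exact List.isChain_cons_cons.2 ⟨fun h => Or.inl (hab h), this⟩

variable {t : ℕ}

theorem FreeGroup.exists_separatedPath {X : Type*} [MulAction G X] {u : FreeGroup ι}
    [DecidableEq ι] (hu : u ≠ 1) {v : G} {L : List ((ι × Bool) × G)} (hL : IsSeparatedPath X L)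
    (hv : L = [] ∨ ∀ x : X, v • x ≠ x) :
    ∃ L' : List ((ι × Bool) × G), L' ≠ [] ∧ IsSeparatedPath X L' ∧
      ∀ γ : ι → G, pathVal γ L' = FreeGroup.lift γ u * v * pathVal γ L := by
  have hne : u.toWord ≠ [] := by simpa using hu
  refine ⟨prependLetters v L u.toWord, ?_, hL.prependLetters hv FreeGroup.isReduced_toWord,
    fun γ => by rw [pathVal_prependLetters γ v L hne, FreeGroup.mk_toWord]⟩
  obtain ⟨a, W, hW⟩ := List.exists_cons_of_ne_nil hne
  obtain ⟨c, L', he⟩ := prependLetters_cons_eq v L a W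
  simp [hW, he]

theorem exists_separatedPath_of_forall_ne_one {X : Type*} [MulAction G X]
    {l : List (FreeGroup (Fin t) × G)} (hl : ∀ p ∈ l, p.1 ≠ 1 ∧ ∀ x : X, p.2 • x ≠ x) :
    ∃ L : List ((Fin t × Bool) × G), (l ≠ [] → L ≠ []) ∧ IsSeparatedPath X L ∧
      ∀ γ : Fin t → G, pathVal γ L = wordEval γ
        ((l.map fun p => Monoid.Coprod.inl p.1 * Monoid.Coprod.inr p.2).reverse).prod := by
  induction l using List.reverseRecOn with
  | nil => exact ⟨[], fun h => (h rfl).elim, List.isChain_nil, fun γ => by simp [pathVal]⟩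
  | append_singleton l p ih =>
    obtain ⟨L, -, hL, hval⟩ := ih fun q hq => hl q (List.mem_append_left _ hq)
    obtain ⟨hp, hpx⟩ := hl p (by simp)
    obtain ⟨L', hne, hL', hval'⟩ := FreeGroup.exists_separatedPath hp hL (Or.inr hpx)
    refine ⟨L', fun _ => hne, hL', fun γ => ?_⟩
    rw [hval', hval]
    simp [wordEval]

theorem IsConstantForm.exists_separatedPath {X : Type*} [MulAction G X]
    {w : FreeGroup (Fin t) ∗ G} {l : List (FreeGroup (Fin t) × G)} (h : IsConstantForm w l)
    (hl : ∀ p ∈ l, ∀ x : X, p.2 • x ≠ x) :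
    ∃ (c : G) (L : List ((Fin t × Bool) × G)), (L = [] → c ≠ 1) ∧ IsSeparatedPath X L ∧
      ∀ γ : Fin t → G, wordEval γ w = c * pathVal γ L := by
  obtain ⟨l, p, rfl⟩ := (List.eq_nil_or_concat' l).resolve_left h.ne_nil
  have hdrop : ∀ q ∈ l, q.1 ≠ 1 := by simpa using h.variable_ne_one
  obtain ⟨L, -, hL, hval⟩ := exists_separatedPath_of_forall_ne_one (X := X) fun q hq =>
    ⟨hdrop q hq, hl q (List.mem_append_left _ hq)⟩
  have hw (γ : Fin t → G) :
      wordEval γ w = FreeGroup.lift γ p.1 * p.2 * pathVal γ L := by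
    rw [hval, h.eq_prod]
    simp [wordEval]
  -- A trivial `uₙ` leaves `vₙ` as the outer constant; for `n = 1` the path is then empty and `c =
  -- vₙ ≠ 1`.
  by_cases hp : p.1 = 1
  · exact ⟨p.2, L, fun _ => h.constant_ne_one p (by simp), hL, fun γ => by rw [hw, hp]; simp⟩
  · obtain ⟨L', hne, hL', hval'⟩ :=
      FreeGroup.exists_separatedPath hp hL (Or.inr (hl p (by simp)))
    exact ⟨1, L', fun h => (hne h).elim, hL', fun γ => by rw [hw, hval', one_mul]⟩

theorem smul_ne_of_formOscSet_eq_univ {X : Type u} [MulAction G X]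
    {l : List (FreeGroup (Fin t) × G)} (h : formOscSet X l = Set.univ) :
    ∀ p ∈ l, ∀ x : X, p.2 • x ≠ x := by
  intro p hp x
  obtain ⟨i, rfl⟩ := List.get_of_mem hp
  have hi := Set.iInter_eq_univ.1 h i
  rw [← Set.smul_set_univ (a := ((l.take i).map fun p => p.2⁻¹).prod), smul_left_cancel_iff] at hi
  exact (hi.symm ▸ Set.mem_univ x : x ∈ actionSupport X (l.get i).2)

theorem exists_separatedPath_of_oscSet_eq_univ {X : Type u} [MulAction G X] [Nonempty X]
    {w : FreeGroup (Fin t) ∗ G} (hw : w ≠ 1) (hO : oscSet X w = Set.univ) :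
    ∃ (c : G) (L : List ((Fin t × Bool) × G)), (L = [] → c ≠ 1) ∧ IsSeparatedPath X L ∧
      ∀ γ : Fin t → G, wordEval γ w = c * pathVal γ L := by
  by_cases hr : w ∈ (Monoid.Coprod.inl : FreeGroup (Fin t) →* FreeGroup (Fin t) ∗ G).range
  · obtain ⟨u, rfl⟩ := hr
    obtain ⟨L, hne, hL, hval⟩ := FreeGroup.exists_separatedPath (X := X) (v := (1 : G)) (L := [])
      (u := u) (fun h => hw (by rw [h, map_one])) List.isChain_nil (Or.inl rfl)
    exact ⟨1, L, fun h => (hne h).elim, hL, fun γ => by simp [hval, wordEval, pathVal]⟩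
  · have hform (x : X) : ∃ l, IsConstantForm w l ∧ x ∈ formOscSet X l :=
      (hO.symm ▸ Set.mem_univ x : x ∈ oscSet X w).resolve_left fun h => hr h.1
    obtain ⟨l, hl, -⟩ := hform (Classical.arbitrary X)
    refine hl.exists_separatedPath (smul_ne_of_formOscSet_eq_univ
      (Set.eq_univ_of_forall fun x => ?_))
    -- A priori the form witnessing membership depends on `x`; uniqueness makes it the same for all
    -- branches.
    obtain ⟨l', hl', hx⟩ := hform x
    rwa [hl.unique hl']

end WordPaths

theorem mainTheorem9 {G : Type v} [Group G] [TopologicalSpace G] [IsTopologicalGroup G]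
    [CompactSpace G] [T2Space G] [TotallyDisconnectedSpace G]
    [MeasurableSpace G] [BorelSpace G]
    (T : RootedTree.{u}) [MulAction G T] [CovariantClass G T HSMul.hSMul LE.le]
    (hcont : ∀ a : T, IsOpen (MulAction.stabilizer G a : Set G))
    (hG : IsWeaklyBranchAction G T)
    (μ : Measure G) [μ.IsHaarMeasure] [IsProbabilityMeasure μ]
    (t : ℕ) (w : FreeGroup (Fin t) ∗ G)
    (hw : IsExplicitlyOscillating T.Boundary w)
    (hO : oscSet T.Boundary w = Set.univ) :
    ∀ᵐ γ ∂(Measure.pi fun _ : Fin t => μ), wordEval γ w ≠ 1 := by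
  obtain ⟨hw1, x, -⟩ := hw
  have : Nonempty T.Boundary := ⟨x⟩
  obtain ⟨c, L, hc, hL, hval⟩ := exists_separatedPath_of_oscSet_eq_univ hw1 hO
  simp only [hval]
  by_cases hnil : L = []
  · subst hnil
    simp [pathVal, hc rfl]
  -- If `w(γ) = 1`, the path sends `x` to `c⁻¹ • x`, a translate of the starting point, which is the
  -- empty suffix.
  · filter_upwards [ae_pathVal_smul_ne hcont hG μ x hL (List.nil_suffix) (Ne.symm hnil) c⁻¹]
      with γ hγ he
    apply hγ
    rw [eq_inv_of_mul_eq_one_right he, pathVal, one_smul]
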